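/- **Theorem 4.1.** For a complex matrix $Y$, let $r(Y)$, $\mathscr R(Y)$ and $Y^*$ denote its rank, its range (column space) and its conjugate transpose, and let $\mathbb C_t^{q\times p}$ be the set of complex $q\times p$ matrices of rank $t$. Let $A\in\mathbb C^{m\times n}$, $B\in\mathbb C^{m\times p}$, $C\in\mathbb C^{q\times n}$ be given, and for $X\in\mathbb C^{q\times p}$ put $$\phi(X)=\begin{bmatrix}A&B\\ C&X\end{bmatrix},\qquad G=[\,A,\ B\,],\qquad H=\begin{bmatrix}A\\ C\end{bmatrix},\qquad M=\begin{bmatrix}A&B\\ C&0\end{bmatrix}.$$ Let $s,t$ be integers with $0\le s\le t\le\min\{p,q\}$. Then: (a) One has $$\max_{X\in\mathbb C_t^{q\times p}} r[\phi(X)]=\min\{\,r(G)+q,\ r(H)+p,\ r(M)+t\,\},$$ $$\min_{X\in\mathbb C_t^{q\times p}} r[\phi(X)]=\max\{\,r(G)+r(H)-r(A),\ r(G)+r(H)-r(M)+t,\ r(M)-t\,\}.$$ In consequence, if $m+q=n+p$: (i) there exists $X\in\mathbb C_t^{q\times p}$ such that $\phi(X)$ is nonsingular if and only if $r(G)=m$,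 $r(H)=n$ and $r(M)\ge m+q-t$; (ii) $\phi(X)$ is nonsingular for all $X\in\mathbb C_t^{q\times p}$ if and only if $r(G)+r(H)-r(A)=m+q$, or $r(G)+r(H)-r(M)=m+q-t$, or ($r(M)=m+q$ and $t=0$). (b) If $\mathscr R(B)\subseteq\mathscr R(A)$ and $\mathscr R(C^*)\subseteq\mathscr R(A^*)$, then $$\max_{X\in\mathbb C_t^{q\times p}} r[\phi(X)]=\min\{\,r(A)+q,\ r(A)+p,\ r(M)+t\,\},$$ $$\min_{X\in\mathbb C_t^{q\times p}} r[\phi(X)]=\max\{\,r(A),\ 2r(A)-r(M)+t,\ r(M)-t\,\}.$$ (c) If $\mathscr R(A)\subseteq\mathscr R(B)$ and $\mathscr R(A^*)\subseteq\mathscr R(C^*)$, then $$\max_{X\in\mathbb C_t^{q\times p}} r[\phi(X)]=\min\{\,r(B)+q,\ r(C)+p,\ r(B)+r(C)+t\,\},$$ $$\min_{X\in\mathbb C_t^{q\times p}} r[\phi(X)]=\max\{\,r(B)+r(C)-r(A),\ t,\ r(B)+r(C)-t\,\}.$$ (d) One has $$\max_{X\in\mathbb C^{q\times p},\ s\le r(X)\le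 t} r[\phi(X)]=\min\{\,r(G)+q,\ r(H)+p,\ r(M)+t\,\},$$ $$\min_{X\in\mathbb C^{q\times p},\ s\le r(X)\le t} r[\phi(X)]=\min\{u_s,u_{s+1},\ldots,u_t\},$$ where $u_l=\max\{\,r(G)+r(H)-r(A),\ r(G)+r(H)-r(M)+l,\ r(M)-l\,\}$ for $l=s,s+1,\ldots,t$. -/

import Mathlib

open Matrix

/-- `ℂ_t^{a × b}`: the complex `a × b` matrices of rank exactly `t`. -/
def fixedRank (a b t : ℕ) : Set (Matrix (Fin a) (Fin b) ℂ) := {X | X.rank = t}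

/-- The complex `a × b` matrices `X` with `s ≤ rank X ≤ t`. -/
def boundedRank (a b s t : ℕ) : Set (Matrix (Fin a) (Fin b) ℂ) := {X | s ≤ X.rank ∧ X.rank ≤ t}

/-- The range (column space) of a complex matrix. -/
def colRange {a b : ℕ} (A : Matrix (Fin a) (Fin b) ℂ) : Submodule ℂ (Fin a → ℂ) :=
  LinearMap.range A.mulVecLin

/-- The partially specified block matrix `φ(X) = [[A, B], [C, X]]`. -/
def phi {m n p q : ℕ} (A : Matrix (Fin m) (Fin n) ℂ) (B : Matrix (Fin m) (Fin p) ℂ)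
    (C : Matrix (Fin q) (Fin n) ℂ) (X : Matrix (Fin q) (Fin p) ℂ) :
    Matrix (Fin m ⊕ Fin q) (Fin n ⊕ Fin p) ℂ :=
  fromBlocks A B C X

/-- The set of ranks (as integers) of `φ(X)` as `X` runs over the feasible set `S`. -/
def phiRanks {m n p q : ℕ} (A : Matrix (Fin m) (Fin n) ℂ) (B : Matrix (Fin m) (Fin p) ℂ)
    (C : Matrix (Fin q) (Fin n) ℂ) (S : Set (Matrix (Fin q) (Fin p) ℂ)) : Set ℤ :=
  (fun X => ((phi A B C X).rank : ℤ)) '' S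

/-- When `m + q = n + p`, the block matrix `φ(X)` written as a square matrix of order `m + q`,
with rows and columns in their natural order. -/
def phiSquare {m n p q : ℕ} (h : m + q = n + p) (A : Matrix (Fin m) (Fin n) ℂ)
    (B : Matrix (Fin m) (Fin p) ℂ) (C : Matrix (Fin q) (Fin n) ℂ)
    (X : Matrix (Fin q) (Fin p) ℂ) : Matrix (Fin (m + q)) (Fin (m + q)) ℂ :=
  reindex finSumFinEquiv (finSumFinEquiv.trans (finCongr h.symm)) (phi A B C X)

section RankBasics

variable {K : Type*} [Field K] {a b c : Type*} [Fintype b] [Fintype c]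

theorem rank_add_finrank_ker (A : Matrix a b K) :
    A.rank + Module.finrank K (LinearMap.ker A.mulVecLin) = Fintype.card b := by
  have h := A.mulVecLin.finrank_range_add_finrank_ker
  rwa [Module.finrank_fintype_fun_eq_card] at h

theorem rank_add_le_rank_add_rank (A B : Matrix a b K) : (A + B).rank ≤ A.rank + B.rank := by
  unfold Matrix.rank
  rw [mulVecLin_add]
  exact (Submodule.finrank_mono (LinearMap.range_add_le _ _)).trans
    (Submodule.finrank_add_le_finrank_add_finrank _ _)

theorem rank_neg_eq (A : Matrix a b K) : (-A).rank = A.rank := by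
  unfold Matrix.rank
  have h : (-A).mulVecLin = -A.mulVecLin := LinearMap.ext fun x => by simp
  rw [h, LinearMap.range_neg]

theorem rank_sub_le_rank_add_rank (A B : Matrix a b K) : (A - B).rank ≤ A.rank + B.rank := by
  rw [sub_eq_add_neg, ← rank_neg_eq B]
  exact rank_add_le_rank_add_rank _ _

theorem rank_le_rank_sub_add_rank (A B : Matrix a b K) : A.rank ≤ (A - B).rank + B.rank := by
  simpa using rank_add_le_rank_add_rank (A - B) B

/-- The rank of `[A, B]` in terms of the subspace of those `w` with `B w` in the range of `A`. -/
theorem rank_fromCols_add_finrank_comap (A : Matrix a b K) (B : Matrix a c K) :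
    (fromCols A B).rank +
        Module.finrank K ((LinearMap.range A.mulVecLin).comap B.mulVecLin) =
      A.rank + Fintype.card c := by
  classical
  let W := (LinearMap.range A.mulVecLin).comap B.mulVecLin
  have hr : LinearMap.range (fromCols A B).mulVecLin =
      LinearMap.range A.mulVecLin ⊔ LinearMap.range B.mulVecLin := by
    ext x
    simp only [LinearMap.mem_range, Submodule.mem_sup, mulVecLin_apply]
    constructor
    · rintro ⟨v, rfl⟩
      exact ⟨_, ⟨v ∘ Sum.inl, rfl⟩, _, ⟨v ∘ Sum.inr, rfl⟩, by rw [fromCols_mulVec]⟩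
    · rintro ⟨_, ⟨v, rfl⟩, _, ⟨w, rfl⟩, rfl⟩
      exact ⟨Sum.elim v w, by rw [fromCols_mulVec_sumElim]⟩
  have h1 := Submodule.finrank_sup_add_finrank_inf_eq
    (LinearMap.range A.mulVecLin) (LinearMap.range B.mulVecLin)
  have h2 := (B.mulVecLin.domRestrict W).finrank_range_add_finrank_ker
  have h3 : LinearMap.range (B.mulVecLin.domRestrict W) =
      LinearMap.range A.mulVecLin ⊓ LinearMap.range B.mulVecLin := by
    rw [LinearMap.range_domRestrict, Submodule.map_comap_eq, inf_comm]
  have h4 : Module.finrank K (LinearMap.ker (B.mulVecLin.domRestrict W)) =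
      Module.finrank K (LinearMap.ker B.mulVecLin) := by
    rw [LinearMap.ker_domRestrict]
    exact (Submodule.comapSubtypeEquivOfLe
      (fun x hx => by
        rw [Submodule.mem_comap, LinearMap.mem_ker.1 hx]; exact zero_mem _)).finrank_eq
  have h5 := rank_add_finrank_ker B
  rw [h3, h4] at h2
  rw [← hr] at h1
  unfold Matrix.rank at *
  change _ + Module.finrank K W = _
  omega

theorem rank_fromCols_of_range_le {A : Matrix a b K} {B : Matrix a c K}
    (h : LinearMap.range B.mulVecLin ≤ LinearMap.range A.mulVecLin) :
    (fromCols A B).rank = A.rank := by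
  have h1 := rank_fromCols_add_finrank_comap A B
  have h2 : (LinearMap.range A.mulVecLin).comap B.mulVecLin = ⊤ :=
    eq_top_iff.2 fun x _ => h ⟨x, rfl⟩
  rw [h2, finrank_top, Module.finrank_fintype_fun_eq_card] at h1
  omega

theorem rank_fromCols_comm (A : Matrix a b K) (B : Matrix a c K) :
    (fromCols A B).rank = (fromCols B A).rank := by
  rw [← rank_submatrix (fromCols A B) (Equiv.refl a) (Equiv.sumComm c b)]
  congr 1
  ext i (j | j) <;> rfl

theorem rank_fromRows_transpose [Fintype a] (A : Matrix a c K) (B : Matrix b c K) :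
    (fromRows A B).rank = (fromCols Aᵀ Bᵀ).rank := by
  rw [← rank_transpose, transpose_fromRows]

theorem mulVec_injective_of_rank {Q : Matrix a b K} (h : Q.rank = Fintype.card b) :
    Function.Injective Q.mulVecLin := by
  have := rank_add_finrank_ker Q
  rw [← LinearMap.ker_eq_bot, ← Submodule.finrank_eq_zero (R := K)]
  omega

theorem rank_mul_of_rank_left {Q : Matrix a b K} (h : Q.rank = Fintype.card b)
    (X : Matrix b c K) : (Q * X).rank = X.rank := by
  unfold Matrix.rank
  rw [mulVecLin_mul, LinearMap.range_comp]
  exact (Submodule.equivMapOfInjective _ (mulVec_injective_of_rank h) _).finrank_eq.symm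

theorem rank_mul_of_rank_right [Fintype a] {P : Matrix b c K} (h : P.rank = Fintype.card b)
    (X : Matrix a b K) : (X * P).rank = X.rank := by
  rw [← rank_transpose, transpose_mul, rank_mul_of_rank_left (by rwa [rank_transpose]),
    rank_transpose]

theorem exists_mul_eq_one_of_rank [Fintype a] [DecidableEq a] {P : Matrix a b K}
    (h : P.rank = Fintype.card a) : ∃ R : Matrix b a K, P * R = 1 := by
  rw [← mulVec_surjective_iff_exists_right_inverse]
  have h1 : LinearMap.range P.mulVecLin = ⊤ :=
    Submodule.eq_top_of_finrank_eq (by rw [Module.finrank_fintype_fun_eq_card]; exact h)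
  exact LinearMap.range_eq_top.1 h1

/-- Sylvester's inequality. -/
theorem rank_add_rank_le_rank_mul_add (P : Matrix a b K) (X : Matrix b c K) :
    P.rank + X.rank ≤ (P * X).rank + Fintype.card b := by
  have h := (P.mulVecLin.domRestrict (LinearMap.range X.mulVecLin)).finrank_range_add_finrank_ker
  have h2 : Module.finrank K (LinearMap.ker
      (P.mulVecLin.domRestrict (LinearMap.range X.mulVecLin))) ≤
      Module.finrank K (LinearMap.ker P.mulVecLin) := by
    rw [LinearMap.ker_domRestrict, ← Submodule.finrank_map_subtype_eq]
    exact Submodule.finrank_mono (Submodule.map_comap_le _ _)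
  have h3 := rank_add_finrank_ker P
  rw [LinearMap.range_domRestrict, ← LinearMap.range_comp, ← mulVecLin_mul] at h
  unfold Matrix.rank at *
  omega

theorem det_ne_zero_iff_rank_eq [Fintype a] [DecidableEq a] (A : Matrix a a K) :
    A.det ≠ 0 ↔ A.rank = Fintype.card a := by
  refine ⟨rank_of_det_ne_zero, fun h => ?_⟩
  have := mulVec_injective_of_rank h
  rw [← isUnit_iff_ne_zero, ← isUnit_iff_isUnit_det, ← mulVec_injective_iff_isUnit]
  exact this

end RankBasics

section Compression

variable {K : Type*} [Field K] {a b : Type*} [Fintype a] [Fintype b]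

/-- Every matrix over a field has an inner generalized inverse. -/
theorem exists_mul_mul_self_eq (A : Matrix a b K) : ∃ N : Matrix b a K, A * N * A = A := by
  classical
  obtain ⟨r, hr⟩ := A.mulVecLin.rangeRestrict.exists_rightInverse_of_surjective
    (LinearMap.range_rangeRestrict _)
  obtain ⟨g, hg⟩ := LinearMap.exists_extend r
  refine ⟨LinearMap.toMatrix' g, ext_of_mulVec_single fun j => ?_⟩
  generalize (Pi.single j 1 : b → K) = x
  have h1 : g (A *ᵥ x) = r (A.mulVecLin.rangeRestrict x) := by
    rw [← hg]; rfl
  have h2 := congrArg Subtype.val (LinearMap.congr_fun hr (A.mulVecLin.rangeRestrict x))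
  rw [← mulVec_mulVec, ← mulVec_mulVec, LinearMap.toMatrix'_mulVec, h1]
  exact h2

/-- Every subspace of a coordinate space is the kernel of a matrix of full row rank. -/
theorem exists_ker_mulVecLin_eq (W : Submodule K (a → K)) :
    ∃ (r : ℕ) (P : Matrix (Fin r) a K), P.rank = r ∧ LinearMap.ker P.mulVecLin = W := by
  classical
  let e := (Module.finBasis K ((a → K) ⧸ W)).equivFun
  let f : (a → K) →ₗ[K] (Fin _ → K) := e.toLinearMap ∘ₗ W.mkQ
  have hf : (LinearMap.toMatrix' f).mulVecLin = f := by
    rw [← toLin'_apply', toLin'_toMatrix']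
  refine ⟨_, LinearMap.toMatrix' f, ?_, ?_⟩
  · have h1 : LinearMap.range f = ⊤ := by
      rw [LinearMap.range_eq_top]
      exact e.surjective.comp W.mkQ_surjective
    rw [Matrix.rank, hf, h1, finrank_top, Module.finrank_fintype_fun_eq_card, Fintype.card_fin]
  · rw [hf, LinearEquiv.ker_comp, Submodule.ker_mkQ]

/-- Every subspace of a coordinate space is the range of a matrix of full column rank. -/
theorem exists_range_mulVecLin_eq (W : Submodule K (a → K)) :
    ∃ (r : ℕ) (Q : Matrix a (Fin r) K), Q.rank = r ∧ LinearMap.range Q.mulVecLin = W := by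
  classical
  let e := (Module.finBasis K W).equivFun.symm
  let f : (Fin _ → K) →ₗ[K] (a → K) := W.subtype ∘ₗ e.toLinearMap
  have hf : (LinearMap.toMatrix' f).mulVecLin = f := by
    rw [← toLin'_apply', toLin'_toMatrix']
  have h1 : LinearMap.range f = W := by
    rw [LinearEquiv.range_comp, Submodule.range_subtype]
  exact ⟨_, LinearMap.toMatrix' f, by rw [Matrix.rank, hf, h1], by rw [hf, h1]⟩

variable {c d : Type*} [Fintype c] [Fintype d]

/-- The rank of a block matrix with one free block `X` is, up to a constant, the rank of an affine
compression of `X`. -/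
theorem exists_rank_fromBlocks_eq (A : Matrix a b K) (B : Matrix a c K) (C : Matrix d b K) :
    ∃ (p' q' : ℕ) (P : Matrix (Fin q') d K) (Q : Matrix c (Fin p') K)
      (E : Matrix (Fin q') (Fin p') K),
      P.rank = q' ∧ Q.rank = p' ∧
      (fromCols A B).rank + p' = A.rank + Fintype.card c ∧
      (fromRows A C).rank + q' = A.rank + Fintype.card d ∧
      ∀ X : Matrix d c K, (fromBlocks A B C X).rank + p' =
        (fromRows A C).rank + Fintype.card c + (P * X * Q - E).rank := by
  obtain ⟨q', P, hP, hPk⟩ :=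
    exists_ker_mulVecLin_eq ((LinearMap.ker A.mulVecLin).map C.mulVecLin)
  obtain ⟨p', Q, hQ, hQr⟩ :=
    exists_range_mulVecLin_eq ((LinearMap.range A.mulVecLin).comap B.mulVecLin)
  obtain ⟨N, hN⟩ := exists_mul_mul_self_eq A
  refine ⟨p', q', P, Q, P * (C * N * B) * Q, hP, hQ, ?_, ?_, fun X => ?_⟩
  · have := rank_fromCols_add_finrank_comap A B
    rwa [← hQr, ← Matrix.rank, hQ] at this
  · have h1 := rank_add_finrank_ker P
    have h2 := (C.mulVecLin.domRestrict (LinearMap.ker A.mulVecLin)).finrank_range_add_finrank_ker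
    have h3 := rank_add_finrank_ker A
    have h4 := rank_add_finrank_ker (fromRows A C)
    have h5 : LinearMap.ker (fromRows A C).mulVecLin =
        LinearMap.ker A.mulVecLin ⊓ LinearMap.ker C.mulVecLin := by
      ext x
      simp only [LinearMap.mem_ker, Submodule.mem_inf, mulVecLin_apply, fromRows_mulVec]
      rw [← Sum.elim_zero_zero, Sum.elim_eq_iff]
    rw [LinearMap.range_domRestrict, ← hPk, LinearMap.ker_domRestrict,
      ← Submodule.finrank_map_subtype_eq, Submodule.map_comap_subtype, ← h5] at h2
    omega
  · have h1 := rank_fromCols_add_finrank_comap (fromRows A C) (fromRows B X)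
    have h2 := rank_add_finrank_ker (P * X * Q - P * (C * N * B) * Q)
    have h3 : (LinearMap.range (fromRows A C).mulVecLin).comap (fromRows B X).mulVecLin =
        (LinearMap.ker (P * X * Q - P * (C * N * B) * Q).mulVecLin).map Q.mulVecLin := by
      ext w
      simp only [Submodule.mem_comap, Submodule.mem_map, LinearMap.mem_range, LinearMap.mem_ker,
        mulVecLin_apply, fromRows_mulVec, Sum.elim_eq_iff, sub_mulVec]
      have key : ∀ z v, A *ᵥ v = B *ᵥ (Q *ᵥ z) →
          ((P * X * Q) *ᵥ z - (P * (C * N * B) * Q) *ᵥ z = 0 ↔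
            ∃ y, A *ᵥ y = B *ᵥ (Q *ᵥ z) ∧ C *ᵥ y = X *ᵥ (Q *ᵥ z)) := by
        intro z v hv
        have e1 : A *ᵥ (N *ᵥ (B *ᵥ (Q *ᵥ z))) = B *ᵥ (Q *ᵥ z) := by
          rw [← hv, mulVec_mulVec, mulVec_mulVec, hN]
        have e2 : (P * X * Q) *ᵥ z - (P * (C * N * B) * Q) *ᵥ z =
            P *ᵥ (X *ᵥ (Q *ᵥ z) - C *ᵥ (N *ᵥ (B *ᵥ (Q *ᵥ z)))) := by
          simp only [mulVec_sub, mulVec_mulVec, Matrix.mul_assoc]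
        have e3 : P *ᵥ (X *ᵥ (Q *ᵥ z) - C *ᵥ (N *ᵥ (B *ᵥ (Q *ᵥ z)))) = 0 ↔
            X *ᵥ (Q *ᵥ z) - C *ᵥ (N *ᵥ (B *ᵥ (Q *ᵥ z))) ∈
              (LinearMap.ker A.mulVecLin).map C.mulVecLin := by
          rw [← hPk]; rfl
        rw [e2, e3]
        constructor
        · rintro ⟨k, hk, hk2⟩
          have hk' : A *ᵥ k = 0 := hk
          have hk2' : C *ᵥ k = _ := hk2
          exact ⟨k + N *ᵥ (B *ᵥ (Q *ᵥ z)), by rw [mulVec_add, hk', e1, zero_add],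
            by rw [mulVec_add, hk2', sub_add_cancel]⟩
        · rintro ⟨y, hy1, hy2⟩
          refine ⟨y - N *ᵥ (B *ᵥ (Q *ᵥ z)), ?_, ?_⟩
          · change A *ᵥ _ = 0
            rw [mulVec_sub, e1, hy1, sub_self]
          · change C *ᵥ _ = _
            rw [mulVec_sub, hy2]
      constructor
      · rintro ⟨y, hy1, hy2⟩
        have hw : w ∈ LinearMap.range Q.mulVecLin := by
          rw [hQr]; exact ⟨y, hy1⟩
        obtain ⟨z, rfl⟩ := hw
        exact ⟨z, (key z y hy1).2 ⟨y, hy1, hy2⟩, rfl⟩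
      · rintro ⟨z, hz, rfl⟩
        have hw : Q *ᵥ z ∈ LinearMap.range Q.mulVecLin := ⟨z, rfl⟩
        rw [hQr] at hw
        obtain ⟨v, hv⟩ := hw
        exact (key z v hv).1 hz
    have h4 := (Submodule.equivMapOfInjective _ (mulVec_injective_of_rank
      (by rw [hQ, Fintype.card_fin])) (LinearMap.ker
        (P * X * Q - P * (C * N * B) * Q).mulVecLin)).finrank_eq
    rw [fromCols_fromRows_eq_fromBlocks, h3, ← h4] at h1
    rw [Fintype.card_fin] at h2
    omega

end Compression

section Completion

variable {K : Type*} [Field K] {a b c : Type*} [Fintype b] [Fintype c]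

theorem rank_add_vecMulVec_eq {Z : Matrix a b K} {u : a → K} {v x : b → K}
    (hu : u ∉ LinearMap.range Z.mulVecLin) (hx : Z *ᵥ x = 0) (hvx : v ⬝ᵥ x = 1) :
    (Z + vecMulVec u v).rank = Z.rank + 1 := by
  apply le_antisymm
  · exact (rank_add_le_rank_add_rank _ _).trans (Nat.add_le_add_left (rank_vecMulVec_le _ _) _)
  have hmul : ∀ y, (Z + vecMulVec u v).mulVecLin y = Z *ᵥ y + (v ⬝ᵥ y) • u := by
    intro y
    rw [mulVecLin_apply, add_mulVec, vecMulVec_mulVec]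
    simp
  have hmem : u ∈ LinearMap.range (Z + vecMulVec u v).mulVecLin :=
    ⟨x, by rw [hmul, hx, hvx, one_smul, zero_add]⟩
  have hlt : LinearMap.range Z.mulVecLin < LinearMap.range (Z + vecMulVec u v).mulVecLin := by
    refine lt_of_le_of_ne ?_ fun h => hu (h ▸ hmem)
    rintro _ ⟨y, rfl⟩
    have h1 := Submodule.sub_mem _ (LinearMap.mem_range_self (Z + vecMulVec u v).mulVecLin y)
      (Submodule.smul_mem _ (v ⬝ᵥ y) hmem)
    rwa [hmul, add_sub_cancel_right] at h1
  exact Submodule.finrank_lt_finrank_of_lt hlt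

variable [Fintype a]

/-- A matrix `Z` with `P * Z = Y` can have any rank compatible with the obvious bounds. -/
theorem exists_mul_eq_rank_eq {P : Matrix a b K} (hP : P.rank = Fintype.card a)
    (Y : Matrix a c K) {z : ℕ} (h1 : Y.rank ≤ z) (h2 : z ≤ Fintype.card c)
    (h3 : z + Fintype.card a ≤ Y.rank + Fintype.card b) :
    ∃ Z : Matrix b c K, P * Z = Y ∧ Z.rank = z := by
  classical
  induction z, h1 using Nat.le_induction with
  | base =>
    obtain ⟨R, hR⟩ := exists_mul_eq_one_of_rank hP
    refine ⟨R * Y, by rw [← Matrix.mul_assoc, hR, Matrix.one_mul],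
      le_antisymm (rank_mul_le_right _ _) ?_⟩
    conv_lhs => rw [← Matrix.one_mul Y, ← hR, Matrix.mul_assoc]
    exact rank_mul_le_right _ _
  | succ z hz ih =>
    obtain ⟨Z, hZ, hr⟩ := ih (by omega) (by omega)
    have hu : ∃ u ∈ LinearMap.ker P.mulVecLin, u ∉ LinearMap.range Z.mulVecLin := by
      by_contra! hle
      have e1 := (P.mulVecLin.domRestrict
        (LinearMap.range Z.mulVecLin)).finrank_range_add_finrank_ker
      have e2 := rank_add_finrank_ker P
      rw [LinearMap.range_domRestrict, ← LinearMap.range_comp, ← mulVecLin_mul, hZ,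
        LinearMap.ker_domRestrict,
        (Submodule.comapSubtypeEquivOfLe hle).finrank_eq] at e1
      unfold Matrix.rank at *
      omega
    obtain ⟨u, hPu, hu⟩ := hu
    have hx : ∃ x, Z *ᵥ x = 0 ∧ x ≠ 0 := by
      by_contra! hle
      have e1 := rank_add_finrank_ker Z
      rw [(Submodule.eq_bot_iff (LinearMap.ker Z.mulVecLin)).2 fun x hx => hle x hx,
        finrank_bot] at e1
      omega
    obtain ⟨x, hZx, hx⟩ := hx
    obtain ⟨j, hj⟩ := Function.ne_iff.1 hx
    refine ⟨Z + vecMulVec u (Pi.single j (x j)⁻¹), ?_, ?_⟩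
    · have hPu' : P *ᵥ u = 0 := hPu
      rw [Matrix.mul_add, hZ, mul_vecMulVec, hPu', zero_vecMulVec, add_zero]
    · rw [rank_add_vecMulVec_eq hu hZx, hr]
      rw [single_dotProduct]
      exact inv_mul_cancel₀ hj

/-- A matrix `X` with `P * X * Q = Y` can have any rank compatible with the obvious bounds. -/
theorem exists_mul_mul_eq_rank_eq {d : Type*} [Fintype d] {P : Matrix a b K}
    (hP : P.rank = Fintype.card a) {Q : Matrix c d K} (hQ : Q.rank = Fintype.card d)
    (Y : Matrix a d K) {t : ℕ} (h1 : Y.rank ≤ t) (hb : t ≤ Fintype.card b)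
    (hc : t ≤ Fintype.card c)
    (h2 : t + Fintype.card a + Fintype.card d ≤ Y.rank + Fintype.card b + Fintype.card c) :
    ∃ X : Matrix b c K, P * X * Q = Y ∧ X.rank = t := by
  have hab : Fintype.card a ≤ Fintype.card b := hP ▸ rank_le_card_width P
  have hdc : Fintype.card d ≤ Fintype.card c := hQ ▸ rank_le_card_height Q
  have hYd := rank_le_card_width Y
  obtain ⟨Z, hZ, hr⟩ := exists_mul_eq_rank_eq hP Y
    (z := min t (min (Fintype.card d) (Y.rank + Fintype.card b - Fintype.card a)))
    (by omega) (by omega) (by omega)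
  obtain ⟨X, hX, hXr⟩ := exists_mul_eq_rank_eq (P := Qᵀ) (by rwa [rank_transpose]) Zᵀ (z := t)
    (by rw [rank_transpose]; omega) hb (by rw [rank_transpose]; omega)
  refine ⟨Xᵀ, ?_, by rwa [rank_transpose]⟩
  rw [Matrix.mul_assoc, ← transpose_transpose Q, ← transpose_mul, hX, transpose_transpose, hZ]

end Completion

section NormalForm

variable {K : Type*} [Field K] {a b : Type*} [Fintype a] [Fintype b]

theorem exists_rank_fromRows_eq {e f : ℕ} {V : Matrix (Fin e) a K} (hV : V.rank = e)
    (h : e + f ≤ Fintype.card a) :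
    ∃ W : Matrix (Fin f) a K, (fromRows V W).rank = e + f := by
  have hP : (fromCols (1 : Matrix (Fin e) (Fin e) K) (0 : Matrix (Fin e) (Fin f) K)).rank =
      Fintype.card (Fin e) := by
    rw [rank_fromCols_of_range_le, rank_one]
    rintro _ ⟨x, rfl⟩
    simp
  obtain ⟨Z, hZ, hr⟩ := exists_mul_eq_rank_eq hP V (z := e + f) (by omega) h
    (by rw [Fintype.card_sum, Fintype.card_fin, Fintype.card_fin]; omega)
  rw [← fromRows_toRows Z, fromCols_mul_fromRows, Matrix.one_mul, Matrix.zero_mul, add_zero] at hZ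
  exact ⟨Z.toRows₂, by rw [← hZ, fromRows_toRows, hr]⟩

theorem exists_rank_factorization (E : Matrix a b K) {r : ℕ} (hr : E.rank = r) :
    ∃ (U : Matrix a (Fin r) K) (V : Matrix (Fin r) b K), U.rank = r ∧ V.rank = r ∧ E = U * V := by
  classical
  obtain ⟨r', U, hU, hrange⟩ := exists_range_mulVecLin_eq (LinearMap.range E.mulVecLin)
  have hre : r' = r := by rw [← hU, ← hr, Matrix.rank, hrange, Matrix.rank]
  subst hre
  have h1 : ∀ j, ∃ x, U *ᵥ x = E.col j := by
    intro j
    have : E.col j ∈ LinearMap.range U.mulVecLin := by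
      rw [hrange]; exact ⟨Pi.single j 1, by simp⟩
    exact this
  choose x hx using h1
  have hE : E = U * (of x)ᵀ := by
    ext i j
    exact (congrFun (hx j) i).symm
  refine ⟨U, (of x)ᵀ, hU, le_antisymm (rank_le_card_height _ |>.trans_eq (Fintype.card_fin _)) ?_,
    hE⟩
  exact hr.symm.le.trans ((congrArg Matrix.rank hE).le.trans (rank_mul_le_right _ _))

theorem exists_eq_mul_diagonal_mul (E : Matrix a b K) {e f : ℕ} (he : E.rank = e)
    (ha : e + f ≤ Fintype.card a) (hb : e + f ≤ Fintype.card b) :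
    ∃ (U : Matrix a (Fin e ⊕ Fin f) K) (V : Matrix (Fin e ⊕ Fin f) b K),
      U.rank = e + f ∧ V.rank = e + f ∧
      E = U * diagonal (Sum.elim (fun _ : Fin e => (1 : K)) fun _ : Fin f => 0) * V := by
  obtain ⟨U, V, hU, hV, hE⟩ := exists_rank_factorization E he
  obtain ⟨V', hV'⟩ := exists_rank_fromRows_eq hV hb
  obtain ⟨U', hU'⟩ := exists_rank_fromRows_eq (V := Uᵀ) (by rwa [rank_transpose]) ha
  refine ⟨(fromRows Uᵀ U')ᵀ, fromRows V V', by rwa [rank_transpose], hV', ?_⟩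
  rw [← fromBlocks_diagonal, Matrix.mul_assoc, fromBlocks_mul_fromRows, transpose_fromRows,
    fromCols_mul_fromRows]
  simpa using hE

theorem rank_mul_diagonal_mul {e f : ℕ} {U : Matrix a (Fin e ⊕ Fin f) K}
    {V : Matrix (Fin e ⊕ Fin f) b K} (hU : U.rank = e + f) (hV : V.rank = e + f)
    (x : Fin e → K) (y : Fin f → K) {k l : ℕ}
    (hx : Nat.card {i // x i ≠ 0} = k) (hy : Nat.card {i // y i ≠ 0} = l) :
    (U * diagonal (Sum.elim x y) * V).rank = k + l := by
  classical
  rw [rank_mul_of_rank_right (by simpa using hV), rank_mul_of_rank_left (by simpa using hU),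
    rank_diagonal, Fintype.card_congr (Equiv.subtypeSum ..), Fintype.card_sum, ← hx, ← hy,
    Nat.card_eq_fintype_card, Nat.card_eq_fintype_card]
  rfl

theorem diagonal_sumElim_sub {R α β : Type*} [AddGroup R] [DecidableEq α] [DecidableEq β]
    (x x' : α → R) (y y' : β → R) :
    diagonal (Sum.elim x y) - diagonal (Sum.elim x' y') =
      diagonal (Sum.elim (x - x') (y - y')) := by
  rw [diagonal_sub]
  congr 1
  ext (i | i) <;> rfl

theorem card_subtype_fin_of_iff_lt {n r : ℕ} {s : Fin n → Prop} (hr : r ≤ n)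
    (hs : ∀ i, s i ↔ i.val < r) : Nat.card {i // s i} = r := by
  classical
  rw [Nat.card_eq_fintype_card, Fintype.card_subtype, Finset.filter_congr fun i _ => hs i,
    Fin.card_filter_val_lt]
  exact min_eq_right hr

theorem card_subtype_fin_of_iff_le {n r : ℕ} {s : Fin n → Prop} (hr : r ≤ n)
    (hs : ∀ i, s i ↔ r ≤ i.val) : Nat.card {i // s i} = n - r := by
  classical
  have h1 := card_subtype_fin_of_iff_lt (s := fun i => ¬ s i) hr fun i => by rw [hs, not_le]
  have h2 := Fintype.card_subtype_compl s
  have h3 := Fintype.card_subtype_le s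
  rw [Fintype.card_fin] at h2 h3
  rw [Nat.card_eq_fintype_card] at h1 ⊢
  omega

/-- Matrices `Y` of rank `k` for which `Y - E` has the largest possible rank. -/
theorem exists_rank_eq_rank_sub_eq_min (E : Matrix a b K) [NeZero (2 : K)] {k : ℕ}
    (ha : k ≤ Fintype.card a) (hb : k ≤ Fintype.card b) :
    ∃ Y : Matrix a b K, Y.rank = k ∧
      (Y - E).rank = min (Fintype.card a) (min (Fintype.card b) (E.rank + k)) := by
  have hEa := rank_le_card_height E
  have hEb := rank_le_card_width E
  obtain ⟨e, he⟩ : ∃ e, E.rank = e := ⟨_, rfl⟩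
  obtain ⟨f, hf⟩ : ∃ f, e + f = min (Fintype.card a) (Fintype.card b) :=
    ⟨min (Fintype.card a) (Fintype.card b) - e, by omega⟩
  obtain ⟨U, V, hU, hV, hE⟩ := exists_eq_mul_diagonal_mul E he (f := f) (by omega) (by omega)
  refine ⟨U * diagonal (Sum.elim (fun i : Fin e => if i.val < k - f then (2 : K) else 0)
    fun i : Fin f => if i.val < min k f then 1 else 0) * V, ?_, ?_⟩
  · rw [rank_mul_diagonal_mul hU hV _ _
      (card_subtype_fin_of_iff_lt (r := k - f) (by omega) fun i => ?_)
      (card_subtype_fin_of_iff_lt (r := min k f) (by omega) fun i => ?_)]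
    · omega
    · split_ifs with h <;> simp [h, two_ne_zero]
    · split_ifs with h <;> simp [h]
  · rw [he]
    conv_lhs => rw [hE]
    rw [← Matrix.sub_mul, ← Matrix.mul_sub, diagonal_sumElim_sub,
      rank_mul_diagonal_mul hU hV _ _
        (card_subtype_fin_of_iff_lt (r := e) le_rfl fun i => ?_)
        (card_subtype_fin_of_iff_lt (r := min k f) (by omega) fun i => ?_)]
    · omega
    · have : (2 : K) - 1 = 1 := by norm_num
      simp only [Pi.sub_apply]
      split_ifs <;> simp [this]
    · simp only [Pi.sub_apply, sub_zero]
      split_ifs with h <;> simp [h]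

/-- Matrices `Y` of rank `k` for which `Y - E` has the smallest possible rank. -/
theorem exists_rank_eq_rank_sub_eq_dist (E : Matrix a b K) {k : ℕ}
    (ha : k ≤ Fintype.card a) (hb : k ≤ Fintype.card b) :
    ∃ Y : Matrix a b K, Y.rank = k ∧ (Y - E).rank = (k - E.rank) + (E.rank - k) := by
  have hEa := rank_le_card_height E
  have hEb := rank_le_card_width E
  obtain ⟨e, he⟩ : ∃ e, E.rank = e := ⟨_, rfl⟩
  obtain ⟨f, hf⟩ : ∃ f, e + f = min (Fintype.card a) (Fintype.card b) :=
    ⟨min (Fintype.card a) (Fintype.card b) - e, by omega⟩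
  obtain ⟨U, V, hU, hV, hE⟩ := exists_eq_mul_diagonal_mul E he (f := f) (by omega) (by omega)
  refine ⟨U * diagonal (Sum.elim (fun i : Fin e => if i.val < min k e then (1 : K) else 0)
    fun i : Fin f => if i.val < k - e then 1 else 0) * V, ?_, ?_⟩
  · rw [rank_mul_diagonal_mul hU hV _ _
      (card_subtype_fin_of_iff_lt (r := min k e) (by omega) fun i => ?_)
      (card_subtype_fin_of_iff_lt (r := k - e) (by omega) fun i => ?_)]
    · omega
    · split_ifs with h <;> simp [h]
    · split_ifs with h <;> simp [h]
  · rw [he]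
    conv_lhs => rw [hE]
    rw [← Matrix.sub_mul, ← Matrix.mul_sub, diagonal_sumElim_sub,
      rank_mul_diagonal_mul hU hV _ _
        (card_subtype_fin_of_iff_le (r := min k e) (by omega) fun i => ?_)
        (card_subtype_fin_of_iff_lt (r := k - e) (by omega) fun i => ?_)]
    · omega
    · rw [← not_lt]
      simp only [Pi.sub_apply]
      split_ifs with h <;> simp [h]
    · simp only [Pi.sub_apply, sub_zero]
      split_ifs with h <;> simp [h]

end NormalForm

section RankExtrema

variable {m n p q : ℕ} (A : Matrix (Fin m) (Fin n) ℂ) (B : Matrix (Fin m) (Fin p) ℂ)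
  (C : Matrix (Fin q) (Fin n) ℂ)

/-- The largest and the smallest rank of `fromBlocks A B C X` for `X` of rank `t`. -/
theorem rank_fromBlocks_extrema {t : ℕ} (hp : t ≤ p) (hq : t ≤ q) :
    IsGreatest (phiRanks A B C (fixedRank q p t))
        (min (((fromCols A B).rank : ℤ) + q) (min (((fromRows A C).rank : ℤ) + p)
          (((fromBlocks A B C 0).rank : ℤ) + t))) ∧
      IsLeast (phiRanks A B C (fixedRank q p t))
        (max (((fromCols A B).rank : ℤ) + (fromRows A C).rank - A.rank)
          (max (((fromCols A B).rank : ℤ) + (fromRows A C).rank - (fromBlocks A B C 0).rank + t)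
            (((fromBlocks A B C 0).rank : ℤ) - t))) := by
  obtain ⟨p', q', P, Q, E, hP, hQ, hG, hH, hX⟩ := exists_rank_fromBlocks_eq A B C
  have hM := hX 0
  rw [Matrix.mul_zero, Matrix.zero_mul, zero_sub, rank_neg_eq] at hM
  simp only [Fintype.card_fin] at hG hH hX hM
  have hP' : P.rank = Fintype.card (Fin q') := by rw [hP, Fintype.card_fin]
  have hQ' : Q.rank = Fintype.card (Fin p') := by rw [hQ, Fintype.card_fin]
  have hqq : q' ≤ q := hP ▸ rank_le_width P
  have hpp : p' ≤ p := hQ ▸ rank_le_height Q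
  have hEq := rank_le_height E
  have hEp := rank_le_width E
  have bounds : ∀ X : Matrix (Fin q) (Fin p) ℂ, X.rank = t →
      (P * X * Q - E).rank ≤ q' ∧ (P * X * Q - E).rank ≤ p' ∧
      (P * X * Q - E).rank ≤ t + E.rank ∧ E.rank ≤ (P * X * Q - E).rank + t ∧
      t + q' + p' ≤ (P * X * Q - E).rank + E.rank + q + p := by
    intro X ht
    have h1 := rank_sub_le_rank_add_rank (P * X * Q) E
    have h2 := rank_le_rank_sub_add_rank E (P * X * Q)
    have h3 := rank_le_rank_sub_add_rank (P * X * Q) E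
    have h4 : (P * X * Q).rank ≤ X.rank :=
      (rank_mul_le_left _ _).trans (rank_mul_le_right _ _)
    have h5 := rank_add_rank_le_rank_mul_add P X
    have h6 := rank_add_rank_le_rank_mul_add (P * X) Q
    rw [← neg_sub, rank_neg_eq] at h2
    rw [Fintype.card_fin] at h5 h6
    refine ⟨rank_le_height _, rank_le_width _, ?_, ?_, ?_⟩ <;> omega
  have completion : ∀ Y : Matrix (Fin q') (Fin p') ℂ, Y.rank ≤ t →
      t + q' + p' ≤ Y.rank + q + p → ∃ X : Matrix (Fin q) (Fin p) ℂ,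
        P * X * Q = Y ∧ X.rank = t := by
    intro Y h1 h2
    apply exists_mul_mul_eq_rank_eq hP' hQ' Y h1 <;> simpa
  refine ⟨⟨?_, ?_⟩, ⟨?_, ?_⟩⟩
  · obtain ⟨Y, hY, hYE⟩ := exists_rank_eq_rank_sub_eq_min E (k := min t (min q' p'))
      (by rw [Fintype.card_fin]; omega) (by rw [Fintype.card_fin]; omega)
    obtain ⟨X, rfl, ht⟩ := completion Y (by omega) (by omega)
    refine ⟨X, ht, ?_⟩
    have := hX X
    simp only [Fintype.card_fin] at hYE
    simp only [phi]
    omega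
  · rintro _ ⟨X, ht, rfl⟩
    have h1 := hX X
    obtain ⟨h2, h3, h4, -, -⟩ := bounds X ht
    simp only [phi]
    omega
  · obtain ⟨Y, hY, hYE⟩ := exists_rank_eq_rank_sub_eq_dist E
      (k := max (min t E.rank) (t + q' + p' - q - p))
      (by rw [Fintype.card_fin]; omega) (by rw [Fintype.card_fin]; omega)
    obtain ⟨X, rfl, ht⟩ := completion Y (by omega) (by omega)
    refine ⟨X, ht, ?_⟩
    have := hX X
    simp only [phi]
    omega
  · rintro _ ⟨X, ht, rfl⟩
    have h1 := hX X
    obtain ⟨-, -, -, h4, h5⟩ := bounds X ht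
    simp only [phi]
    omega

theorem phiSquare_det_ne_zero_iff (h : m + q = n + p) (X : Matrix (Fin q) (Fin p) ℂ) :
    (phiSquare h A B C X).det ≠ 0 ↔ (phi A B C X).rank = m + q := by
  rw [det_ne_zero_iff_rank_eq, phiSquare, rank_reindex, Fintype.card_fin]

variable {A B C}

theorem rank_fromCols_of_colRange_le (h : colRange B ≤ colRange A) :
    (fromCols A B).rank = A.rank :=
  rank_fromCols_of_range_le h

open scoped ComplexOrder in
theorem rank_fromRows_of_colRange_le (h : colRange Cᴴ ≤ colRange Aᴴ) :
    (fromRows A C).rank = A.rank := by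
  rw [← rank_conjTranspose, conjTranspose_fromRows_eq_fromCols_conjTranspose,
    rank_fromCols_of_range_le h, rank_conjTranspose]

theorem rank_fromRows_comm (A : Matrix (Fin m) (Fin n) ℂ) (C : Matrix (Fin q) (Fin n) ℂ) :
    (fromRows A C).rank = (fromRows C A).rank := by
  rw [rank_fromRows_transpose, rank_fromCols_comm, ← rank_fromRows_transpose]

theorem rank_fromBlocks_zero_of_colRange_le (h : colRange A ≤ colRange B) :
    (fromBlocks A B C 0).rank = B.rank + C.rank := by
  have h1 := rank_fromCols_add_finrank_comap
    (fromRows B (0 : Matrix (Fin q) (Fin p) ℂ)) (fromRows A C)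
  have h2 : (LinearMap.range (fromRows B (0 : Matrix (Fin q) (Fin p) ℂ)).mulVecLin).comap
      (fromRows A C).mulVecLin = LinearMap.ker C.mulVecLin := by
    ext x
    simp only [Submodule.mem_comap, LinearMap.mem_range, LinearMap.mem_ker, mulVecLin_apply,
      fromRows_mulVec, Sum.elim_eq_iff, zero_mulVec]
    constructor
    · rintro ⟨y, -, hy⟩
      exact hy.symm
    · intro hx
      obtain ⟨y, hy⟩ := h ⟨x, rfl⟩
      exact ⟨y, hy, hx.symm⟩
  have h3 := rank_add_finrank_ker C
  have h4 : (fromRows B (0 : Matrix (Fin q) (Fin p) ℂ)).rank = B.rank := by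
    rw [rank_fromRows_transpose, rank_fromCols_of_range_le, rank_transpose]
    rintro _ ⟨x, rfl⟩
    simp
  rw [rank_fromCols_comm, fromCols_fromRows_eq_fromBlocks, h2, h4] at h1
  omega

end RankExtrema

theorem theorem4p1 {m n p q : ℕ} (A : Matrix (Fin m) (Fin n) ℂ) (B : Matrix (Fin m) (Fin p) ℂ)
    (C : Matrix (Fin q) (Fin n) ℂ) (s t : ℕ) (hst : s ≤ t) (ht : t ≤ min p q)
    (G : Matrix (Fin m) (Fin n ⊕ Fin p) ℂ) (hG : G = Matrix.fromCols A B)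
    (H : Matrix (Fin m ⊕ Fin q) (Fin n) ℂ) (hH : H = Matrix.fromRows A C)
    (M : Matrix (Fin m ⊕ Fin q) (Fin n ⊕ Fin p) ℂ) (hM : M = Matrix.fromBlocks A B C 0) :
    -- (a)
    (IsGreatest (phiRanks A B C (fixedRank q p t))
        (min ((G.rank : ℤ) + q) (min ((H.rank : ℤ) + p) ((M.rank : ℤ) + t))) ∧
      IsLeast (phiRanks A B C (fixedRank q p t))
        (max ((G.rank : ℤ) + H.rank - A.rank)
          (max ((G.rank : ℤ) + H.rank - M.rank + t) ((M.rank : ℤ) - t))) ∧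
      -- (a)(i)
      (∀ h : m + q = n + p,
        (∃ X ∈ fixedRank q p t, (phiSquare h A B C X).det ≠ 0) ↔
          G.rank = m ∧ H.rank = n ∧ (M.rank : ℤ) ≥ (m : ℤ) + q - t) ∧
      -- (a)(ii)
      (∀ h : m + q = n + p,
        (∀ X ∈ fixedRank q p t, (phiSquare h A B C X).det ≠ 0) ↔
          (G.rank : ℤ) + H.rank - A.rank = (m : ℤ) + q ∨
          (G.rank : ℤ) + H.rank - M.rank = (m : ℤ) + q - t ∨
          (M.rank = m + q ∧ t = 0))) ∧
    -- (b)
    (colRange B ≤ colRange A → colRange C.conjTranspose ≤ colRange A.conjTranspose →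
      IsGreatest (phiRanks A B C (fixedRank q p t))
        (min ((A.rank : ℤ) + q) (min ((A.rank : ℤ) + p) ((M.rank : ℤ) + t))) ∧
      IsLeast (phiRanks A B C (fixedRank q p t))
        (max (A.rank : ℤ) (max (2 * (A.rank : ℤ) - M.rank + t) ((M.rank : ℤ) - t)))) ∧
    -- (c)
    (colRange A ≤ colRange B → colRange A.conjTranspose ≤ colRange C.conjTranspose →
      IsGreatest (phiRanks A B C (fixedRank q p t))
        (min ((B.rank : ℤ) + q) (min ((C.rank : ℤ) + p) ((B.rank : ℤ) + C.rank + t))) ∧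
      IsLeast (phiRanks A B C (fixedRank q p t))
        (max ((B.rank : ℤ) + C.rank - A.rank) (max (t : ℤ) ((B.rank : ℤ) + C.rank - t)))) ∧
    -- (d)
    (IsGreatest (phiRanks A B C (boundedRank q p s t))
        (min ((G.rank : ℤ) + q) (min ((H.rank : ℤ) + p) ((M.rank : ℤ) + t))) ∧
      IsLeast (phiRanks A B C (boundedRank q p s t))
        ((Finset.Icc s t).inf' (Finset.nonempty_Icc.mpr hst) fun l : ℕ =>
          max ((G.rank : ℤ) + H.rank - A.rank)
            (max ((G.rank : ℤ) + H.rank - M.rank + l) ((M.rank : ℤ) - l)))) := by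
  subst hG hH hM
  have hp : t ≤ p := ht.trans (min_le_left _ _)
  have hq : t ≤ q := ht.trans (min_le_right _ _)
  obtain ⟨hmax, hmin⟩ := rank_fromBlocks_extrema A B C hp hq
  have hGm := rank_le_card_height (fromCols A B)
  have hHn := rank_le_card_width (fromRows A C)
  rw [Fintype.card_fin] at hGm hHn
  refine ⟨⟨hmax, hmin, fun h => ?_, fun h => ?_⟩, fun hB hC => ?_, fun hB hC => ?_, ⟨?_, ?_⟩, ?_, ?_⟩
  · simp only [phiSquare_det_ne_zero_iff]
    constructor
    · rintro ⟨X, hX, hr⟩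
      have h1 := hmax.2 ⟨X, hX, rfl⟩
      simp only [hr] at h1
      omega
    · rintro ⟨h1, h2, h3⟩
      obtain ⟨X, hX, hr⟩ := hmax.1
      refine ⟨X, hX, ?_⟩
      dsimp only at hr
      omega
  · simp only [phiSquare_det_ne_zero_iff]
    obtain ⟨X, hX, hr⟩ := hmin.1
    dsimp only at hr
    constructor
    · intro hall
      rw [hall X hX] at hr
      have hMr := rank_le_card_height (fromBlocks A B C 0)
      rw [Fintype.card_sum, Fintype.card_fin, Fintype.card_fin] at hMr
      omega
    · intro hor Z hZ
      have h1 := hmin.2 ⟨Z, hZ, rfl⟩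
      have h2 := rank_le_card_height (phi A B C Z)
      rw [Fintype.card_sum, Fintype.card_fin, Fintype.card_fin] at h2
      dsimp only at h1
      omega
  · rw [rank_fromCols_of_colRange_le hB, rank_fromRows_of_colRange_le hC] at hmax hmin
    refine ⟨hmax, ?_⟩
    convert hmin using 2 <;> ring_nf
  · rw [rank_fromCols_comm, rank_fromCols_of_colRange_le hB, rank_fromRows_comm,
      rank_fromRows_of_colRange_le hC, rank_fromBlocks_zero_of_colRange_le hB] at hmax hmin
    push_cast at hmax hmin
    refine ⟨hmax, ?_⟩
    convert hmin using 3
    ring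
  · obtain ⟨X, hX, hr⟩ := hmax.1
    have hX' : X.rank = t := hX
    exact ⟨X, ⟨by omega, by omega⟩, hr⟩
  · rintro _ ⟨X, ⟨-, hXt⟩, rfl⟩
    have h1 := (rank_fromBlocks_extrema A B C (hXt.trans hp) (hXt.trans hq)).1.2 ⟨X, rfl, rfl⟩
    dsimp only at h1 ⊢
    omega
  · obtain ⟨l, hl, hle⟩ := Finset.exists_mem_eq_inf' (Finset.nonempty_Icc.mpr hst) fun l : ℕ =>
      max (((fromCols A B).rank : ℤ) + (fromRows A C).rank - A.rank)
        (max (((fromCols A B).rank : ℤ) + (fromRows A C).rank - (fromBlocks A B C 0).rank + l)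
          (((fromBlocks A B C 0).rank : ℤ) - l))
    rw [hle]
    obtain ⟨hsl, hlt⟩ := Finset.mem_Icc.1 hl
    obtain ⟨X, hX, hr⟩ := (rank_fromBlocks_extrema A B C (hlt.trans hp) (hlt.trans hq)).2.1
    have hX' : X.rank = l := hX
    exact ⟨X, ⟨by omega, by omega⟩, hr⟩
  · rintro _ ⟨X, ⟨hsX, hXt⟩, rfl⟩
    exact (Finset.inf'_le _ (Finset.mem_Icc.2 ⟨hsX, hXt⟩)).trans
      ((rank_fromBlocks_extrema A B C (hXt.trans hp) (hXt.trans hq)).2.2 ⟨X, rfl, rfl⟩)
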